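/- Let $\Sigma=(\Sigma_n)_{n\in\mathbb N}$ be a signature of finitary operation symbols and let $\mathbf K$ be a quasivariety of $\Sigma$-structures, i.e. a class axiomatizable by quasi-identities $(p_1\approx q_1\wedge\dots\wedge p_n\approx q_n)\to p\approx q$. For a $\Sigma$-structure $A$ let $Co_{\mathbf K}(A)$ be the algebraic lattice, ordered by inclusion, of all congruences $\theta$ of $A$ with $A/\theta\in\mathbf K$; it is a contravariant functor of $A$ via $Co_{\mathbf K}(f)=(f\times f)^{-1}$. Suppose that $(Co_{\mathbf K},i)$ is a filter pair, i.e. that for every $\Sigma$-structure $A$ a map $i_A\colon Co_{\mathbf K}(A)\to\wp(A)$ is given which preserves arbitrary infima and suprema of nonempty directed sets, and that $i_A\circ Co_{\mathbf K}(h)=h^{-1}\circ i_B$ for every homomorphism $h\colon A\to B$. Let $X$ be a set of variables with at least two elements, and let $Fm(X)$ be the $\Sigma$-structure of $\Sigma$-formulas over $X$. The logic associated to the filter pair is the consequence relation on $Fm(X)$ given by $$\Gamma\vdash\varphi\iff\text{for all }\theta\in Co_{\mathbf K}(Fm(X)):\ \Gamma\subseteq i_{Fm(X)}(\theta)\Rightarrow\varphi\in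 i_{Fm(X)}(\theta).$$ If $i_{Fm(X)}\colon Co_{\mathbf K}(Fm(X))\to\wp(Fm(X))$ is injective, then this logic is algebraizable in the sense of Blok and Pigozzi, with equivalent algebraic semantics $\mathbf K$. That is, there are a finite set $\tau$ of equations $\delta\approx\epsilon$ in one variable and a finite set $\Delta(p,q)$ of formulas in two variables such that the following hold. Here, for $\Gamma\subseteq Fm(X)$, $\tau(\Gamma)=\{\delta(\gamma)\approx\epsilon(\gamma):\gamma\in\Gamma,\ \delta\approx\epsilon\in\tau\}$; for a set $E$ of equations over $X$, $\Delta(E)=\{d(\xi,\eta):\xi\approx\eta\in E,\ d\in\Delta\}$; $E\models_{\mathbf K}\varphi\approx\psi$ means that every homomorphism $h\colon Fm(X)\to A$ with $A\in\mathbf K$ which identifies both sides of each equation in $E$ satisfies $h(\varphi)=h(\psi)$; and a set on the right of $\vdash$ or $\models_{\mathbf K}$ means each of its members. 1. For all $\Gamma\subseteq Fm(X)$ and $\varphi\in Fm(X)$: $\Gamma\vdash\varphi\iff\tau(\Gamma)\models_{\mathbf K}\tau(\{\varphi\})$. 2. For every set $E$ of equations over $X$ and all $\varphi,\psi\in Fm(X)$: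 $E\models_{\mathbf K}\varphi\approx\psi\iff\Delta(E)\vdash\Delta(\{\varphi\approx\psi\})$. 3. For every $\psi\in Fm(X)$: $\{\psi\}\vdash\Delta(\tau(\{\psi\}))$ and $\Delta(\tau(\{\psi\}))\vdash\psi$. -/

import Mathlib

universe u

/-! Signatures are algebraic first-order languages (function symbols only), `Σ`-structures are
Mathlib's structures for them, and `Fm(X)` is the type of terms `L.Term X`. -/

namespace CongruenceFilterPairs

open FirstOrder FirstOrder.Language


/-- The formula algebra `Fm(X)`: terms with their syntactic operations. -/
instance termStructure (L : FirstOrder.Language.{u, 0}) [L.IsAlgebraic] (X : Type u) :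
    L.Structure (L.Term X) where
  funMap f ts := Term.func f ts
  RelMap r := isEmptyElim r

/-- A class of `Σ`-structures. -/
abbrev AlgClass (L : FirstOrder.Language.{u, 0}) : Type (u + 1) :=
  ∀ (A : Type u) [L.Structure A], Prop

/-- An equation between terms in the variables `α`. -/
abbrev Equation (L : FirstOrder.Language.{u, 0}) (α : Type*) := L.Term α × L.Term α

/-- A quasi-identity `(p₁ ≈ q₁ ∧ … ∧ pₙ ≈ qₙ) → p ≈ q`; here `n = 0` is allowed. -/
structure QuasiIdentity (L : FirstOrder.Language.{u, 0}) where
  premises : List (Equation L ℕ)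
  conclusion : Equation L ℕ

/-- The structure `A` satisfies the quasi-identity `q`. -/
def QuasiIdentity.Holds {L : FirstOrder.Language.{u, 0}} (q : QuasiIdentity L)
    (A : Type u) [L.Structure A] : Prop :=
  ∀ v : ℕ → A, (∀ e ∈ q.premises, e.1.realize v = e.2.realize v) →
    q.conclusion.1.realize v = q.conclusion.2.realize v

/-- A quasivariety is a class of structures axiomatizable by quasi-identities. -/
def IsQuasivariety {L : FirstOrder.Language.{u, 0}} (K : AlgClass L) : Prop :=
  ∃ Q : Set (QuasiIdentity L),
    ∀ (A : Type u) [L.Structure A], K A ↔ ∀ q ∈ Q, q.Holds A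

/-! ### Congruences -/

/-- A congruence on a structure. -/
@[ext]
structure Congruence (L : FirstOrder.Language.{u, 0}) (A : Type u) [L.Structure A] extends Setoid A where
  funMap_congr : ∀ {n : ℕ} (f : L.Functions n) (x y : Fin n → A),
    (∀ i, r (x i) (y i)) → r (Structure.funMap f x) (Structure.funMap f y)

/-- The data that makes Mathlib's `quotientStructure` put the usual structure on `A / θ`. -/
instance Congruence.prestructure {L : FirstOrder.Language.{u, 0}} [L.IsAlgebraic] {A : Type u}
    [S : L.Structure A] (θ : Congruence L A) : L.Prestructure θ.toSetoid where
  toStructure := S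
  fun_equiv x y h := θ.funMap_congr _ x y h
  rel_equiv {_ r} _ _ _ := isEmptyElim r

/-- The quotient structure `A / θ`. -/
abbrev Congruence.Quot {L : FirstOrder.Language.{u, 0}} {A : Type u} [L.Structure A]
    (θ : Congruence L A) : Type u := Quotient θ.toSetoid

/-- Congruences are ordered by inclusion. -/
instance {L : FirstOrder.Language.{u, 0}} {A : Type u} [L.Structure A] : PartialOrder (Congruence L A) where
  le θ η := ∀ a b, θ.r a b → η.r a b
  le_refl _ _ _ h := h
  le_trans _ _ _ h₁ h₂ a b h := h₂ a b (h₁ a b h)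
  le_antisymm θ η h₁ h₂ := by
    ext a b
    exact ⟨h₁ a b, h₂ a b⟩

/-- `Co_K(A)`: the congruences `θ` of `A` with `A / θ ∈ K`, ordered by inclusion. -/
abbrev KCongruence {L : FirstOrder.Language.{u, 0}} [L.IsAlgebraic] (K : AlgClass L)
    (A : Type u) [L.Structure A] : Type u :=
  {θ : Congruence L A // K θ.Quot}

/-- The congruence `(f × f)⁻¹(θ)`. -/
def Congruence.comap {L : FirstOrder.Language.{u, 0}} {A B : Type u} [L.Structure A] [L.Structure B]
    (f : A →[L] B) (θ : Congruence L B) : Congruence L A where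
  r a b := θ.r (f a) (f b)
  iseqv := ⟨fun _ => θ.iseqv.refl _, fun h => θ.iseqv.symm h, fun h k => θ.iseqv.trans h k⟩
  funMap_congr g x y h := by
    rw [HomClass.map_fun, HomClass.map_fun]
    exact θ.funMap_congr g _ _ h

/-- The intersection of a set of congruences. -/
def Congruence.inter {L : FirstOrder.Language.{u, 0}} {A : Type u} [L.Structure A]
    (S : Set (Congruence L A)) : Congruence L A where
  r a b := ∀ θ ∈ S, θ.r a b
  iseqv := ⟨fun _ θ _ => θ.iseqv.refl _, fun h θ hθ => θ.iseqv.symm (h θ hθ),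
    fun h k θ hθ => θ.iseqv.trans (h θ hθ) (k θ hθ)⟩
  funMap_congr g x y h θ hθ := θ.funMap_congr g x y fun i => h i θ hθ

theorem exists_common {α : Type*} [Preorder α] {S : Set α} (hS : S.Nonempty)
    (hd : DirectedOn (· ≤ ·) S) {ι : Type*} (p : ι → α → Prop)
    (hp : ∀ i a b, a ≤ b → p i a → p i b) (l : List ι) (h : ∀ i ∈ l, ∃ a ∈ S, p i a) :
    ∃ a ∈ S, ∀ i ∈ l, p i a := by
  induction l with
  | nil => exact ⟨hS.some, hS.some_mem, by simp⟩
  | cons i l ih =>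
    obtain ⟨a, ha, h₁⟩ := ih fun j hj => h j (List.mem_cons_of_mem _ hj)
    obtain ⟨b, hb, h₂⟩ := h i List.mem_cons_self
    obtain ⟨c, hc, hac, hbc⟩ := hd a ha b hb
    refine ⟨c, hc, fun j hj => ?_⟩
    rcases List.mem_cons.1 hj with rfl | hj
    · exact hp _ _ _ hbc h₂
    · exact hp _ _ _ hac (h₁ j hj)

/-- The union of a nonempty directed set of congruences. -/
def Congruence.directedUnion {L : FirstOrder.Language.{u, 0}} {A : Type u} [L.Structure A]
    (S : Set (Congruence L A)) (hS : S.Nonempty) (hd : DirectedOn (· ≤ ·) S) :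
    Congruence L A where
  r a b := ∃ θ ∈ S, θ.r a b
  iseqv := by
    refine ⟨fun _ => ⟨hS.some, hS.some_mem, hS.some.iseqv.refl _⟩, ?_, ?_⟩
    · rintro a b ⟨θ, hθ, h⟩
      exact ⟨θ, hθ, θ.iseqv.symm h⟩
    · rintro a b c ⟨θ, hθ, h⟩ ⟨η, hη, k⟩
      obtain ⟨ζ, hζ, h₁, h₂⟩ := hd θ hθ η hη
      exact ⟨ζ, hζ, ζ.iseqv.trans (h₁ _ _ h) (h₂ _ _ k)⟩
  funMap_congr {n} g x y h := by
    obtain ⟨θ, hθ, k⟩ := exists_common hS hd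
      (fun (i : Fin n) (θ : Congruence L A) => θ.r (x i) (y i))
      (fun i _ _ hle => hle _ _) (List.finRange n) (fun i _ => h i)
    exact ⟨θ, hθ, θ.funMap_congr g x y fun i => k i (List.mem_finRange i)⟩

/-- `A / θ` satisfies `q` iff `θ` is closed under the instances of `q` in `A`. -/
theorem QuasiIdentity.holds_quot {L : FirstOrder.Language.{u, 0}} [L.IsAlgebraic] (q : QuasiIdentity L)
    {A : Type u} [L.Structure A] (θ : Congruence L A) :
    q.Holds θ.Quot ↔ ∀ v : ℕ → A, (∀ e ∈ q.premises, θ.r (e.1.realize v) (e.2.realize v)) →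
      θ.r (q.conclusion.1.realize v) (q.conclusion.2.realize v) := by
  have key : ∀ (v : ℕ → A) (s t : L.Term ℕ),
      s.realize (fun i => (⟦v i⟧ : θ.Quot)) = t.realize (fun i => (⟦v i⟧ : θ.Quot)) ↔
        θ.r (s.realize v) (t.realize v) := by
    intro v s t
    rw [Term.realize_quotient_mk', Term.realize_quotient_mk']
    exact Quotient.eq
  constructor
  · intro h v hv
    exact (key v _ _).1 (h _ fun e he => (key v _ _).2 (hv e he))
  · intro h v hv
    obtain ⟨w, rfl⟩ : ∃ w : ℕ → A, v = fun i => (⟦w i⟧ : θ.Quot) :=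
      ⟨fun i => (v i).out, funext fun i => (Quotient.out_eq (v i)).symm⟩
    exact (key w _ _).2 (h w fun e he => (key w _ _).1 (hv e he))

theorem IsQuasivariety.comap {L : FirstOrder.Language.{u, 0}} [L.IsAlgebraic] {K : AlgClass L}
    (hK : IsQuasivariety K) {A B : Type u} [L.Structure A] [L.Structure B] (f : A →[L] B)
    {θ : Congruence L B} (hθ : K θ.Quot) : K (θ.comap f).Quot := by
  obtain ⟨Q, hQ⟩ := hK
  rw [hQ] at hθ ⊢
  intro q hq
  have h := (q.holds_quot θ).1 (hθ q hq)
  refine (q.holds_quot _).2 fun v hv => ?_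
  have h' := h (f ∘ v)
  simp only [HomClass.realize_term] at h'
  exact h' hv

theorem IsQuasivariety.inter {L : FirstOrder.Language.{u, 0}} [L.IsAlgebraic] {K : AlgClass L}
    (hK : IsQuasivariety K) {A : Type u} [L.Structure A] {S : Set (Congruence L A)}
    (hS : ∀ θ ∈ S, K θ.Quot) : K (Congruence.inter S).Quot := by
  obtain ⟨Q, hQ⟩ := hK
  rw [hQ]
  intro q hq
  refine (q.holds_quot _).2 fun v hv θ hθ => ?_
  exact (q.holds_quot θ).1 ((hQ _).1 (hS θ hθ) q hq) v fun e he => hv e he θ hθ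

theorem IsQuasivariety.directedUnion {L : FirstOrder.Language.{u, 0}} [L.IsAlgebraic] {K : AlgClass L}
    (hK : IsQuasivariety K) {A : Type u} [L.Structure A] {S : Set (Congruence L A)}
    (hne : S.Nonempty) (hd : DirectedOn (· ≤ ·) S)
    (hS : ∀ θ ∈ S, K θ.Quot) : K (Congruence.directedUnion S hne hd).Quot := by
  obtain ⟨Q, hQ⟩ := hK
  rw [hQ]
  intro q hq
  refine (q.holds_quot _).2 fun v hv => ?_
  obtain ⟨θ, hθ, k⟩ := exists_common hne hd
    (fun (e : Equation L ℕ) (θ : Congruence L A) => θ.r (e.1.realize v) (e.2.realize v))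
    (fun e _ _ hle => hle _ _) q.premises hv
  exact ⟨θ, hθ, (q.holds_quot θ).1 ((hQ _).1 (hS θ hθ) q hq) v k⟩

/-- `Co_K(A)` is a complete lattice, infima being intersections. -/
@[reducible]
def kCongruenceLattice {L : FirstOrder.Language.{u, 0}} [L.IsAlgebraic] {K : AlgClass L}
    (hK : IsQuasivariety K) (A : Type u) [L.Structure A] : CompleteLattice (KCongruence K A) :=
  @completeLatticeOfInf (KCongruence K A) _
    ⟨fun S => ⟨Congruence.inter (Subtype.val '' S),
      hK.inter (by rintro _ ⟨θ, _, rfl⟩; exact θ.2)⟩⟩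
    (fun S => ⟨fun θ hθ _ _ h => h θ.1 ⟨θ, hθ, rfl⟩, by
      rintro η hη a b h _ ⟨θ, hθ, rfl⟩
      exact hη hθ a b h⟩)

theorem sInf_r {L : FirstOrder.Language.{u, 0}} [L.IsAlgebraic] {K : AlgClass L}
    (hK : IsQuasivariety K) (A : Type u) [L.Structure A] (S : Set (KCongruence K A)) (a b : A) :
    ((kCongruenceLattice hK A).sInf S).1.r a b ↔ ∀ θ ∈ S, θ.1.r a b := by
  change (∀ η ∈ Subtype.val '' S, η.r a b) ↔ _
  simp only [Set.forall_mem_image]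

/-- Directed suprema in `Co_K(A)` are unions. -/
theorem sSup_r {L : FirstOrder.Language.{u, 0}} [L.IsAlgebraic] {K : AlgClass L}
    (hK : IsQuasivariety K) (A : Type u) [L.Structure A] (S : Set (KCongruence K A))
    (hne : S.Nonempty) (hd : DirectedOn (· ≤ ·) S) (a b : A) :
    ((kCongruenceLattice hK A).sSup S).1.r a b ↔ ∃ θ ∈ S, θ.1.r a b := by
  let _ := kCongruenceLattice hK A
  constructor
  · intro h
    have hne' : (Subtype.val '' S).Nonempty := hne.image _
    have hd' : DirectedOn (· ≤ ·) (Subtype.val '' S) := by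
      rintro _ ⟨θ, hθ, rfl⟩ _ ⟨η, hη, rfl⟩
      obtain ⟨ζ, hζ, h₁, h₂⟩ := hd θ hθ η hη
      exact ⟨ζ.1, ⟨ζ, hζ, rfl⟩, h₁, h₂⟩
    let U : KCongruence K A := ⟨Congruence.directedUnion _ hne' hd',
      hK.directedUnion hne' hd' (by rintro _ ⟨θ, _, rfl⟩; exact θ.2)⟩
    have hU : sSup S ≤ U := sSup_le fun θ hθ a b h => ⟨θ.1, ⟨θ, hθ, rfl⟩, h⟩
    obtain ⟨_, ⟨θ, hθ, rfl⟩, h'⟩ := hU a b h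
    exact ⟨θ, hθ, h'⟩
  · rintro ⟨θ, hθ, h⟩
    exact (le_sSup hθ : θ ≤ sSup S) a b h

theorem kCongruence_algebraic {L : FirstOrder.Language.{u, 0}} [L.IsAlgebraic] {K : AlgClass L}
    (hK : IsQuasivariety K) (A : Type u) [L.Structure A] :
    @IsCompactlyGenerated (KCongruence K A) (kCongruenceLattice hK A) := by
  let _ := kCongruenceLattice hK A
  -- the `K`-congruence generated by one pair
  let g : A → A → KCongruence K A := fun a b => sInf {θ | θ.1.r a b}
  have hg : ∀ a b, (g a b).1.r a b := fun a b => (sInf_r hK A _ a b).2 fun θ hθ => hθ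
  have hle : ∀ a b (θ : KCongruence K A), θ.1.r a b → g a b ≤ θ := fun a b θ h => sInf_le h
  refine ⟨fun θ => ⟨{η | ∃ a b, θ.1.r a b ∧ η = g a b}, ?_, ?_⟩⟩
  · rintro _ ⟨a, b, -, rfl⟩
    intro S s hne hd hs hle'
    have hs' : s = sSup S := hs.unique (isLUB_sSup S)
    subst hs'
    obtain ⟨θ, hθ, h⟩ := (sSup_r hK A S hne hd a b).1 (hle' a b (hg a b))
    exact ⟨θ, hθ, hle a b θ h⟩
  · apply le_antisymm
    · refine sSup_le ?_
      rintro _ ⟨a, b, h, rfl⟩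
      exact hle a b θ h
    · intro a b h
      have : g a b ≤ sSup {η | ∃ a b, θ.1.r a b ∧ η = g a b} := le_sSup ⟨a, b, h, rfl⟩
      exact this a b (hg a b)

/-! ### Filter pairs -/

/-- A contravariant functor from `Σ`-structures to the category of algebraic lattices and maps
preserving arbitrary infima and (nonempty) directed suprema. -/
structure AlgLatFunctor (L : FirstOrder.Language.{u, 0}) where
  obj : ∀ (A : Type u) [L.Structure A], Type u
  lattice : ∀ (A : Type u) [L.Structure A], CompleteLattice (obj A)
  algebraic : ∀ (A : Type u) [L.Structure A], IsCompactlyGenerated (obj A)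
  map : ∀ {A B : Type u} [L.Structure A] [L.Structure B], (A →[L] B) → obj B → obj A
  map_sInf : ∀ {A B : Type u} [L.Structure A] [L.Structure B] (f : A →[L] B) (S : Set (obj B)),
    map f (sInf S) = sInf (map f '' S)
  map_sSup : ∀ {A B : Type u} [L.Structure A] [L.Structure B] (f : A →[L] B) (S : Set (obj B)),
    S.Nonempty → DirectedOn (· ≤ ·) S → map f (sSup S) = sSup (map f '' S)
  map_id : ∀ (A : Type u) [L.Structure A] (x : obj A), map (Hom.id L A) x = x
  map_comp : ∀ {A B C : Type u} [L.Structure A] [L.Structure B] [L.Structure C]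
    (g : B →[L] C) (f : A →[L] B) (x : obj C), map (g.comp f) x = map f (map g x)

attribute [instance] AlgLatFunctor.lattice

/-- A filter pair `(G, i)`; the structure is the transformation `i` for a given functor `G`. -/
structure FilterPair (L : FirstOrder.Language.{u, 0}) (G : AlgLatFunctor L) where
  i : ∀ (A : Type u) [L.Structure A], G.obj A → Set A
  i_sInf : ∀ (A : Type u) [L.Structure A] (S : Set (G.obj A)), i A (sInf S) = ⋂ x ∈ S, i A x
  i_sSup : ∀ (A : Type u) [L.Structure A] (S : Set (G.obj A)),
    S.Nonempty → DirectedOn (· ≤ ·) S → i A (sSup S) = ⋃ x ∈ S, i A x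
  naturality : ∀ {A B : Type u} [L.Structure A] [L.Structure B] (h : A →[L] B) (x : G.obj B),
    i A (G.map h x) = h ⁻¹' i B x

/-- The functor `Co_K` for a quasivariety `K`, acting on homomorphisms by `(f × f)⁻¹`. -/
def Co {L : FirstOrder.Language.{u, 0}} [L.IsAlgebraic] (K : AlgClass L) (hK : IsQuasivariety K) :
    AlgLatFunctor L where
  obj A := KCongruence K A
  lattice A := kCongruenceLattice hK A
  algebraic A := kCongruence_algebraic hK A
  map f θ := ⟨θ.1.comap f, hK.comap f θ.2⟩
  map_sInf {A B} _ _ f S := by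
    apply Subtype.ext
    ext a b
    refine (sInf_r hK B S (f a) (f b)).trans (Iff.trans ?_ (sInf_r hK A _ a b).symm)
    rw [Set.forall_mem_image]
    rfl
  map_sSup {A B} _ _ f S hne hd := by
    apply Subtype.ext
    ext a b
    refine (sSup_r hK B S hne hd (f a) (f b)).trans
      (Iff.trans ?_ (sSup_r hK A _ (hne.image _) ?_ a b).symm)
    · rw [Set.exists_mem_image]
      rfl
    · rintro _ ⟨θ, hθ, rfl⟩ _ ⟨η, hη, rfl⟩
      obtain ⟨ζ, hζ, h₁, h₂⟩ := hd θ hθ η hη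
      exact ⟨_, ⟨ζ, hζ, rfl⟩, fun a b h => h₁ _ _ h, fun a b h => h₂ _ _ h⟩
  map_id _ _ _ := rfl
  map_comp _ _ _ := rfl

/-! ### Logics -/

/-- A Tarskian consequence relation on a `Σ`-structure. -/
structure AbstractLogic (L : FirstOrder.Language.{u, 0}) (A : Type u) [L.Structure A] where
  entails : Set A → A → Prop
  reflexivity : ∀ (Γ : Set A) (φ : A), φ ∈ Γ → entails Γ φ
  cut : ∀ (Γ Δ : Set A) (φ : A), entails Γ φ → (∀ ψ ∈ Γ, entails Δ ψ) → entails Δ φ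
  monotonicity : ∀ (Γ Δ : Set A) (φ : A), Γ ⊆ Δ → entails Γ φ → entails Δ φ
  finitarity : ∀ (Γ : Set A) (φ : A), entails Γ φ → ∃ Δ ⊆ Γ, Δ.Finite ∧ entails Δ φ
  structurality : ∀ (Γ : Set A) (φ : A) (σ : A →[L] A), entails Γ φ → entails (σ '' Γ) (σ φ)

/-- A logic over the signature, with variables in `X`. -/
abbrev Logic (L : FirstOrder.Language.{u, 0}) [L.IsAlgebraic] (X : Type u) := AbstractLogic L (L.Term X)

/-- The consequence relation of a filter pair on a structure `A`: `Γ ⊢ φ` iff for every `z ∈ G(A)`,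
`Γ ⊆ i_A(z)` implies `φ ∈ i_A(z)`. -/
def FilterPair.abstractLogic {L : FirstOrder.Language.{u, 0}} {G : AlgLatFunctor L} (F : FilterPair L G)
    (A : Type u) [L.Structure A] : AbstractLogic L A where
  entails Γ φ := ∀ z : G.obj A, Γ ⊆ F.i A z → φ ∈ F.i A z
  reflexivity _ _ h _ hz := hz h
  cut _ _ _ h k z hz := h z fun ψ hψ => k ψ hψ z hz
  monotonicity _ _ _ h k z hz := k z (h.trans hz)
  finitarity Γ φ h := by
    classical
    let c : Set A → G.obj A := fun D => sInf {z | D ⊆ F.i A z}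
    have hc : ∀ D, D ⊆ F.i A (c D) := by
      intro D a ha
      simp only [c, F.i_sInf, Set.mem_iInter]
      exact fun z hz => hz ha
    have hmono : ∀ D E, D ⊆ E → c D ≤ c E := fun D E hDE =>
      sInf_le_sInf fun z hz => hDE.trans hz
    let S : Set (G.obj A) := {z | ∃ D ⊆ Γ, D.Finite ∧ z = c D}
    have hne : S.Nonempty := ⟨c ∅, ∅, Set.empty_subset _, Set.finite_empty, rfl⟩
    have hd : DirectedOn (· ≤ ·) S := by
      rintro _ ⟨D, hD, hDf, rfl⟩ _ ⟨E, hE, hEf, rfl⟩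
      exact ⟨c (D ∪ E), ⟨D ∪ E, Set.union_subset hD hE, hDf.union hEf, rfl⟩,
        hmono _ _ Set.subset_union_left, hmono _ _ Set.subset_union_right⟩
    have hΓ : Γ ⊆ F.i A (sSup S) := by
      intro a ha
      rw [F.i_sSup A S hne hd]
      refine Set.mem_iUnion₂.2 ⟨c {a}, ⟨{a}, by simpa using ha, Set.finite_singleton a, rfl⟩, ?_⟩
      exact hc {a} rfl
    have hφ := h _ hΓ
    rw [F.i_sSup A S hne hd] at hφ
    obtain ⟨_, ⟨D, hD, hDf, rfl⟩, hmem⟩ := Set.mem_iUnion₂.1 hφ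
    refine ⟨D, hD, hDf, fun z hz => ?_⟩
    simp only [c, F.i_sInf, Set.mem_iInter] at hmem
    exact hmem z hz
  structurality Γ φ σ h z hz := by
    have := h (G.map σ z)
    rw [F.naturality] at this
    exact this fun a ha => hz ⟨a, ha, rfl⟩

/-- The logic `(Σ, ⊢^X)` associated to a filter pair. -/
def FilterPair.logic {L : FirstOrder.Language.{u, 0}} [L.IsAlgebraic] {G : AlgLatFunctor L}
    (F : FilterPair L G) (X : Type u) : Logic L X := F.abstractLogic (L.Term X)

/-! ### Algebraizability -/

/-- Equational consequence `Γ ⊨_K^X φ ≈ ψ`. -/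
def EqConsequence {L : FirstOrder.Language.{u, 0}} [L.IsAlgebraic] (K : AlgClass L) {X : Type u}
    (Γ : Set (Equation L X)) (e : Equation L X) : Prop :=
  ∀ (A : Type u) [L.Structure A], K A → ∀ h : L.Term X →[L] A,
    (∀ d ∈ Γ, h d.1 = h d.2) → h e.1 = h e.2

/-- `τ(Γ) = {δ(γ) ≈ ε(γ) : γ ∈ Γ, δ ≈ ε ∈ τ}`, for a set `τ` of equations in one variable. -/
def tauImage {L : FirstOrder.Language.{u, 0}} {X : Type u} (τ : Set (Equation L Unit))
    (Γ : Set (L.Term X)) : Set (Equation L X) :=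
  {e | ∃ d ∈ τ, ∃ γ ∈ Γ, e = (d.1.subst fun _ => γ, d.2.subst fun _ => γ)}

/-- `{ξ Δ η : ξ ≈ η ∈ Γ}`, for a set `Δ(p, q)` of formulas in two variables. -/
def deltaImage {L : FirstOrder.Language.{u, 0}} {X : Type u} (Δ : Set (L.Term (Fin 2)))
    (Γ : Set (Equation L X)) : Set (L.Term X) :=
  {χ | ∃ d ∈ Δ, ∃ e ∈ Γ, χ = d.subst ![e.1, e.2]}

/-- The logic `l` is algebraizable, with equivalent algebraic semantics `K`, in the sense of Blok
and Pigozzi: this is witnessed by a finite set `τ` of equations in one variable and a finite set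
`Δ` of formulas in two variables. -/
def IsAlgebraizable {L : FirstOrder.Language.{u, 0}} [L.IsAlgebraic] {X : Type u} (l : Logic L X)
    (K : AlgClass L) : Prop :=
  ∃ (τ : Set (Equation L Unit)) (Δ : Set (L.Term (Fin 2))), τ.Finite ∧ Δ.Finite ∧
    (∀ (Γ : Set (L.Term X)) (φ : L.Term X),
      l.entails Γ φ ↔ ∀ e ∈ tauImage τ {φ}, EqConsequence K (tauImage τ Γ) e) ∧
    (∀ (Γ : Set (Equation L X)) (e : Equation L X),
      EqConsequence K Γ e ↔ ∀ χ ∈ deltaImage Δ {e}, l.entails (deltaImage Δ Γ) χ) ∧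
    (∀ ψ : L.Term X,
      (∀ χ ∈ deltaImage Δ (tauImage τ {ψ}), l.entails {ψ} χ) ∧
        l.entails (deltaImage Δ (tauImage τ {ψ})) ψ)


end CongruenceFilterPairs

/-!
Write `M = Fm(X)` and view a `K`-congruence of `M` as a set of pairs. Both this embedding of
`Co_K(M)` into `℘(M × M)` and the map `i_M` into `℘(M)` preserve infima and directed suprema;
the first is injective, the second by hypothesis. For two such maps `j`, `k` on a
complete lattice with `j` injective, each condition `b ∈ k θ` on `θ` is equivalent to a finite one `D ⊆ j θ`
(`PreservesInfDirectedSup.exists_finite_subset_iff`): the least `θ` with `b ∈ k θ` is the directed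
supremum of the least `η` with `D ⊆ j η`, where `D` runs through the finite subsets of `j θ`.

Applied to a variable `x`, this gives finitely many equations characterizing `x ∈ i_M(θ)`; applied
to a pair of distinct variables, it gives finitely many formulas characterizing `x θ y`.
Naturality of `i` under the substitutions that collapse all variables to one formula, respectively
send `x` to `ξ` and all other variables to `η`, carries these over to arbitrary formulas
(`exists_tau`) and pairs (`exists_delta`). Since `⊨_K` is membership in all `K`-congruences
extending the premises (`eqConsequence_iff`), the three conditions for algebraizability are then
formal.
-/

namespace CongruenceFilterPairs

open FirstOrder FirstOrder.Language

/-- A map from a complete lattice to a powerset that preserves arbitrary infima and suprema of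
nonempty directed sets. -/
structure PreservesInfDirectedSup {G α : Type*} [CompleteLattice G] (j : G → Set α) : Prop where
  map_sInf : ∀ S : Set G, j (sInf S) = ⋂ θ ∈ S, j θ
  map_sSup : ∀ S : Set G, S.Nonempty → DirectedOn (· ≤ ·) S → j (sSup S) = ⋃ θ ∈ S, j θ

namespace PreservesInfDirectedSup

variable {G α β : Type*} [CompleteLattice G] {j : G → Set α} {k : G → Set β}

theorem mono (hj : PreservesInfDirectedSup j) {θ η : G} (h : θ ≤ η) : j θ ⊆ j η := by
  have h' := hj.map_sInf {θ, η}
  rw [sInf_pair, inf_eq_left.2 h] at h'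
  intro a ha
  rw [h'] at ha
  exact Set.mem_iInter₂.1 ha η (by simp)

theorem subset_map_sInf (hj : PreservesInfDirectedSup j) (D : Set α) :
    D ⊆ j (sInf {θ | D ⊆ j θ}) := by
  rw [hj.map_sInf]
  exact Set.subset_iInter₂ fun _ h => h

/-- If `j` is injective, then the condition `b ∈ k θ` on `θ` amounts to `θ` containing, in the
sense of `j`, some fixed finite set. -/
theorem exists_finite_subset_iff (hj : PreservesInfDirectedSup j)
    (hinj : Function.Injective j) (hk : PreservesInfDirectedSup k) (b : β) :
    ∃ D : Set α, D.Finite ∧ ∀ θ, b ∈ k θ ↔ D ⊆ j θ := by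
  let c : Set α → G := fun D => sInf {θ | D ⊆ j θ}
  let t : G := sInf {θ | b ∈ k θ}
  have ht : b ∈ k t := by
    rw [hk.map_sInf]
    exact Set.mem_iInter₂.2 fun _ h => h
  have hmono : ∀ D E, D ⊆ E → c D ≤ c E := fun D E h => sInf_le_sInf fun _ hθ => h.trans hθ
  let S : Set G := {θ | ∃ D ⊆ j t, D.Finite ∧ θ = c D}
  have hne : S.Nonempty := ⟨c ∅, ∅, Set.empty_subset _, Set.finite_empty, rfl⟩
  have hd : DirectedOn (· ≤ ·) S := by
    rintro _ ⟨D, hD, hDf, rfl⟩ _ ⟨E, hE, hEf, rfl⟩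
    exact ⟨c (D ∪ E), ⟨D ∪ E, Set.union_subset hD hE, hDf.union hEf, rfl⟩,
      hmono _ _ Set.subset_union_left, hmono _ _ Set.subset_union_right⟩
  have hS : sSup S = t := by
    refine hinj (Set.Subset.antisymm (hj.mono (sSup_le ?_)) fun a ha => ?_)
    · rintro _ ⟨D, hD, -, rfl⟩
      exact sInf_le hD
    · rw [hj.map_sSup S hne hd]
      exact Set.mem_iUnion₂.2 ⟨c {a}, ⟨{a}, by simpa using ha, Set.finite_singleton a, rfl⟩,
        hj.subset_map_sInf {a} rfl⟩
  rw [← hS, hk.map_sSup S hne hd] at ht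
  obtain ⟨_, ⟨D, hD, hDf, rfl⟩, hb⟩ := Set.mem_iUnion₂.1 ht
  exact ⟨D, hDf, fun θ => ⟨fun h => hD.trans (hj.mono (sInf_le h)),
    fun h => hk.mono (sInf_le h) hb⟩⟩

end PreservesInfDirectedSup

section

variable {L : FirstOrder.Language.{u, 0}}

theorem FilterPair.preservesInfDirectedSup {G : AlgLatFunctor L} (F : FilterPair L G)
    (A : Type u) [L.Structure A] : PreservesInfDirectedSup (F.i A) :=
  ⟨F.i_sInf A, F.i_sSup A⟩

theorem subst_relabel {α β γ : Type*} (t : L.Term α) (g : α → β) (f : β → L.Term γ) :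
    (t.relabel g).subst f = t.subst (f ∘ g) := by
  induction t with
  | var => rfl
  | func F ts ih =>
    change Term.func F _ = Term.func F _
    congr 1
    funext i
    exact ih i

/-- The kernel of a homomorphism. -/
def Congruence.ker {A B : Type u} [L.Structure A] [L.Structure B] (f : A →[L] B) :
    Congruence L A where
  r a b := f a = f b
  iseqv := ⟨fun _ => rfl, Eq.symm, Eq.trans⟩
  funMap_congr g x y h := by
    rw [HomClass.map_fun, HomClass.map_fun]
    exact congrArg _ (funext h)

variable [L.IsAlgebraic] {K : AlgClass L}

/-- The set of pairs of elements related by a `K`-congruence. -/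
def KCongruence.graph (hK : IsQuasivariety K) (A : Type u) [L.Structure A]
    (θ : (Co K hK).obj A) : Set (A × A) :=
  {e | θ.1.r e.1 e.2}

theorem KCongruence.graph_injective (hK : IsQuasivariety K) (A : Type u) [L.Structure A] :
    Function.Injective (KCongruence.graph hK A) := by
  intro θ η h
  refine Subtype.ext (Congruence.ext ?_)
  funext a b
  exact congrArg (fun s : Set (A × A) => (a, b) ∈ s) h

theorem KCongruence.preservesInfDirectedSup_graph (hK : IsQuasivariety K) (A : Type u)
    [L.Structure A] : PreservesInfDirectedSup (KCongruence.graph hK A) where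
  map_sInf S := by
    ext e
    refine (sInf_r hK A S e.1 e.2).trans ?_
    simp only [Set.mem_iInter]
    rfl
  map_sSup S hne hd := by
    ext e
    refine (sSup_r hK A S hne hd e.1 e.2).trans ?_
    simp only [Set.mem_iUnion, exists_prop]
    rfl

/-- The endomorphism of `Fm(X)` given by a substitution. -/
def substHom {X : Type u} (f : X → L.Term X) : L.Term X →[L] L.Term X where
  toFun t := t.subst f
  map_fun' _ _ := rfl
  map_rel' r := isEmptyElim r

theorem IsQuasivariety.ker (hK : IsQuasivariety K) {A B : Type u} [L.Structure A]
    [L.Structure B] (f : A →[L] B) (hB : K B) : K (Congruence.ker f).Quot := by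
  obtain ⟨Q, hQ⟩ := hK
  rw [hQ] at hB ⊢
  intro q hq
  refine (q.holds_quot _).2 fun v hv => ?_
  have h := hB q hq (f ∘ v)
  simp only [HomClass.realize_term] at h
  exact h hv

/-- The projection onto the quotient by a congruence. -/
def Congruence.mkHom {A : Type u} [L.Structure A] (θ : Congruence L A) : A →[L] θ.Quot where
  toFun a := ⟦a⟧
  map_fun' f x := (funMap_quotient_mk' θ.toSetoid f x).symm
  map_rel' r := isEmptyElim r

theorem eqConsequence_iff (hK : IsQuasivariety K) {X : Type u} (Γ : Set (Equation L X))
    (e : Equation L X) :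
    EqConsequence K Γ e ↔ ∀ θ : (Co K hK).obj (L.Term X),
      Γ ⊆ KCongruence.graph hK (L.Term X) θ → e ∈ KCongruence.graph hK (L.Term X) θ := by
  constructor
  · intro h θ hθ
    exact Quotient.exact
      (h θ.1.Quot θ.2 θ.1.mkHom fun d hd => Quotient.sound (hθ hd))
  · intro h A _ hA f hf
    exact h ⟨Congruence.ker f, hK.ker f hA⟩ hf

/-- Membership of a formula in the filter `i(θ)` is defined by finitely many equations in one
variable. -/
theorem exists_tau (hK : IsQuasivariety K) (F : FilterPair L (Co K hK)) (X : Type u)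
    [Nonempty X] :
    ∃ τ : Set (Equation L Unit), τ.Finite ∧
      ∀ (Γ : Set (L.Term X)) (θ : (Co K hK).obj (L.Term X)),
        Γ ⊆ F.i (L.Term X) θ ↔ tauImage τ Γ ⊆ KCongruence.graph hK (L.Term X) θ := by
  obtain ⟨x⟩ := ‹Nonempty X›
  obtain ⟨D, hD, h⟩ :=
    (KCongruence.preservesInfDirectedSup_graph hK (L.Term X)).exists_finite_subset_iff
      (KCongruence.graph_injective hK _) (F.preservesInfDirectedSup _) (Term.var x)
  let u : X → Unit := fun _ => ()
  refine ⟨(fun e => (e.1.relabel u, e.2.relabel u)) '' D, hD.image _, fun Γ θ => ?_⟩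
  have key : ∀ γ, γ ∈ F.i (L.Term X) θ ↔
      ∀ e ∈ D, θ.1.r (e.1.subst fun _ => γ) (e.2.subst fun _ => γ) := by
    intro γ
    have h' := h ((Co K hK).map (substHom fun _ => γ) θ)
    rw [F.naturality] at h'
    exact h'
  constructor
  · rintro hΓ _ ⟨_, ⟨e, he, rfl⟩, γ, hγ, rfl⟩
    simp only [subst_relabel]
    exact (key γ).1 (hΓ hγ) e he
  · intro hΓ γ hγ
    refine (key γ).2 fun e he => ?_
    have h' := hΓ ⟨_, ⟨e, he, rfl⟩, γ, hγ, rfl⟩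
    simp only [subst_relabel] at h'
    exact h'

/-- If `i` is injective on `Fm(X)`, then membership of an equation in a `K`-congruence `θ` is
defined by membership in `i(θ)` of finitely many formulas in two variables. -/
theorem exists_delta (hK : IsQuasivariety K) (F : FilterPair L (Co K hK)) (X : Type u)
    [Nontrivial X] (hinj : Function.Injective (F.i (L.Term X))) :
    ∃ Δ : Set (L.Term (Fin 2)), Δ.Finite ∧
      ∀ (E : Set (Equation L X)) (θ : (Co K hK).obj (L.Term X)),
        E ⊆ KCongruence.graph hK (L.Term X) θ ↔ deltaImage Δ E ⊆ F.i (L.Term X) θ := by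
  classical
  obtain ⟨x, y, hxy⟩ := exists_pair_ne X
  obtain ⟨D, hD, h⟩ := (F.preservesInfDirectedSup (L.Term X)).exists_finite_subset_iff hinj
      (KCongruence.preservesInfDirectedSup_graph hK (L.Term X)) (Term.var x, Term.var y)
  -- the first variable stands for `x`, the second for every other variable
  let u : X → Fin 2 := fun z => if z = x then 0 else 1
  refine ⟨(fun d => d.relabel u) '' D, hD.image _, fun E θ => ?_⟩
  have key : ∀ e, e ∈ KCongruence.graph hK (L.Term X) θ ↔
      ∀ d ∈ D, d.subst (![e.1, e.2] ∘ u) ∈ F.i (L.Term X) θ := by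
    intro e
    have h' := h ((Co K hK).map (substHom (![e.1, e.2] ∘ u)) θ)
    rw [F.naturality] at h'
    have hx : (substHom (![e.1, e.2] ∘ u)) (Term.var x) = e.1 := by
      change ![e.1, e.2] (u x) = e.1
      simp [u]
    have hy : (substHom (![e.1, e.2] ∘ u)) (Term.var y) = e.2 := by
      change ![e.1, e.2] (u y) = e.2
      simp [u, hxy.symm]
    change θ.1.r (substHom (![e.1, e.2] ∘ u) (Term.var x))
      (substHom (![e.1, e.2] ∘ u) (Term.var y)) ↔ _ at h'
    rw [hx, hy] at h'
    exact h'
  constructor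
  · rintro hE _ ⟨_, ⟨d, hd, rfl⟩, e, he, rfl⟩
    simp only [subst_relabel]
    exact (key e).1 (hE he) d hd
  · intro hE e he
    refine (key e).2 fun d hd => ?_
    have h' := hE ⟨_, ⟨d, hd, rfl⟩, e, he, rfl⟩
    simp only [subst_relabel] at h'
    exact h'

end

end CongruenceFilterPairs

theorem proposition3p7 (L : FirstOrder.Language.{u, 0}) [L.IsAlgebraic]
    (K : CongruenceFilterPairs.AlgClass L) (hK : CongruenceFilterPairs.IsQuasivariety K)
    (F : CongruenceFilterPairs.FilterPair L (CongruenceFilterPairs.Co K hK))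
    (X : Type u) [Nontrivial X]
    (hinj : Function.Injective (F.i (L.Term X))) :
    CongruenceFilterPairs.IsAlgebraizable (F.logic X) K := by
  open CongruenceFilterPairs in
  obtain ⟨τ, hτf, hτ⟩ := exists_tau hK F X
  obtain ⟨Δ, hΔf, hΔ⟩ := exists_delta hK F X hinj
  refine ⟨τ, Δ, hτf, hΔf, fun Γ φ => ?_, fun E e => ?_,
    fun ψ => ⟨fun χ hχ θ hθ => ?_, fun θ hθ => ?_⟩⟩
  · simp only [eqConsequence_iff hK, ← hτ]
    constructor
    · intro h e he θ hθ
      exact (hτ {φ} θ).1 (Set.singleton_subset_iff.2 (h θ hθ)) he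
    · intro h θ hθ
      exact Set.singleton_subset_iff.1 ((hτ {φ} θ).2 fun e he => h e he θ hθ)
  · simp only [eqConsequence_iff hK, hΔ]
    constructor
    · intro h χ hχ θ hθ
      exact (hΔ {e} θ).1 (Set.singleton_subset_iff.2 (h θ hθ)) hχ
    · intro h θ hθ
      exact Set.singleton_subset_iff.1 ((hΔ {e} θ).2 fun χ hχ => h χ hχ θ hθ)
  · exact (hΔ _ θ).1 ((hτ {ψ} θ).1 hθ) hχ
  · exact Set.singleton_subset_iff.1 ((hτ {ψ} θ).2 ((hΔ _ θ).2 hθ))
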